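/- Let $A$ be a bounded linear operator on a complex Hilbert space $\mathcal H$, with numerical range $W(A)=\{\langle Af,f\rangle : f\in\mathcal H,\ \|f\|=1\}$ (a convex set), and let $\lambda\in\partial W(A)$, the topological boundary of $W(A)$ in $\mathbb C$. Suppose that (i) $\lambda$ is not a corner point of $W(A)$, that is, $W(A)$ is not contained in a sector with vertex $\lambda$ and angle less than $\pi$ (so that $W(A)$ has a unique supporting line through $\lambda$); and (ii) $\lambda$ is a point of infinite upper curvature of $\partial W(A)$, that is, after a translation and a rotation of the plane taking $\lambda$ to $0$, the supporting line through $\lambda$ to the real line, and $W(A)$ to a set $\Omega$ contained in the closed upper half-plane, one has $$\limsup_{\substack{(x,y)\to 0\\ x\neq 0,\ (x,y)\in\partial\Omega}}\frac{y}{x^2}=\infty .$$ Then $\lambda$ belongs to the essential spectrum of $A$, that is, $\lambda-A$ is not a Fredholm operator. -/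

import Mathlib

open Filter Topology

/-- The numerical range `W(A) = {⟨A f, f⟩ : ‖f‖ = 1}` of a bounded operator. Mathlib's inner product
is linear in the second variable, so `⟨A f, f⟩` (linear in the first variable) is `inner ℂ f (A f)`. -/
def numericalRange {H : Type*} [NormedAddCommGroup H] [InnerProductSpace ℂ H]
    (A : H →L[ℂ] H) : Set ℂ :=
  {z | ∃ f : H, ‖f‖ = 1 ∧ z = inner ℂ f (A f)}

/-- The essential spectrum: all `z` such that `z - A` is not a Fredholm operator. -/
def essentialSpectrum {H : Type*} [NormedAddCommGroup H] [InnerProductSpace ℂ H]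
    (A : H →L[ℂ] H) : Set ℂ :=
  {z | ¬ (z • ContinuousLinearMap.id ℂ H - A).IsFredholm}

/-- The closed sector with vertex `p` between the rays of directions `exp (α i)` and `exp (β i)`;
its angle is `β - α`. -/
def closedSector (p : ℂ) (α β : ℝ) : Set ℂ :=
  {z | ∃ r θ : ℝ, 0 ≤ r ∧ α ≤ θ ∧ θ ≤ β ∧ z = p + r * Complex.exp (θ * Complex.I)}

/-- The point `p` (of the boundary of `Ω`) is a corner point of `Ω` if `Ω` is contained in a sector
with vertex `p` and angle less than `π`. -/
def IsCornerPoint (Ω : Set ℂ) (p : ℂ) : Prop :=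
  ∃ α β : ℝ, α ≤ β ∧ β - α < Real.pi ∧ Ω ⊆ closedSector p α β

/-- For `‖u‖ = 1`, the line `p + ℝ u` is a supporting line of `Ω` at `p`, and `Ω` lies on its left:
in the coordinates `z = p + u (x + i y)`, the set `Ω` lies in the closed upper half-plane `0 ≤ y`. -/
def IsSupportDirection (Ω : Set ℂ) (p u : ℂ) : Prop :=
  ‖u‖ = 1 ∧ ∀ x y : ℝ, p + u * (x + y * Complex.I) ∈ Ω → 0 ≤ y

/-- The upper curvature of the boundary of `Ω` at `p`, in the coordinates `z = p + u w`,
`w = x + i y`, in which `p` is the origin and the line `p + ℝ u` is the real axis: the limes superior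
of `y / x ^ 2` as `w → 0` with `x ≠ 0` along the boundary. It is computed in `[-∞, ∞]`. -/
noncomputable def upperCurvature (Ω : Set ℂ) (p u : ℂ) : EReal :=
  limsup (fun w : ℂ => ((w.im / w.re ^ 2 : ℝ) : EReal))
    (𝓝[{w : ℂ | w.re ≠ 0 ∧ p + u * w ∈ frontier Ω}] 0)

/-- The boundary point `p` of the convex set `Ω` is a point of infinite upper curvature: either it
is a corner point (these count as points of infinite curvature by convention), or, in coordinates
in which `p` is the origin, the real axis is the supporting line at `p` and `Ω` lies in the closed
upper half-plane, the upper curvature is infinite. (If `p` is not a corner point, then the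
supporting line of `Ω` at `p` is unique.) -/
def IsInfiniteUpperCurvaturePoint (Ω : Set ℂ) (p : ℂ) : Prop :=
  IsCornerPoint Ω p ∨ ∃ u : ℂ, IsSupportDirection Ω p u ∧ upperCurvature Ω p u = ⊤

/-!
Suppose that `z - A` is Fredholm, and pass to `B = conj u • (A - z)`, so that `z` becomes the origin
and the supporting line becomes the real axis. The imaginary part of `B` is then positive
semidefinite, and by its Cauchy–Schwarz inequality the kernel of `B` reduces `B` and contributes
nothing to the quadratic form `⟪f, B f⟫` (`inner_self_apply_add_of_mem_ker`). By the
Toeplitz–Hausdorff theorem, applied to the compression of `B` to `(ker B)ᗮ`, there are two cases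
(`numericalRange_subset_cone_or_exists_small`).

* The values of the form on the unit sphere of `(ker B)ᗮ` stay away from `0`. They can then be
  separated from `0` by a line, so the numerical range lies in a proper cone and `z` is a corner.
* There are unit vectors `f` in `(ker B)ᗮ` with `⟪f, B f⟫` arbitrarily small. The range of `B` is
  closed, so `‖B f‖ ≥ δ > 0`. The vector `f` is nearly annihilated by the imaginary part of `B`, so
  the value of the form at `f + t • B f` is about `2 t ‖B f‖ ^ 2`, with imaginary part `O(t ^ 2)`.
  For both signs of `t` this gives points of the numerical range below a parabola
  (`exists_mem_numericalRange_below_parabola`), and by convexity the boundary near the origin lies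
  below that parabola (`eventually_frontier_im_div_le`): the upper curvature is finite.
-/

open scoped ComplexConjugate

/-! ### Convexity of the numerical range -/

section NumericalRange

variable {H : Type*} [NormedAddCommGroup H] [InnerProductSpace ℂ H]

theorem inner_self_apply_add_smul (B : H →L[ℂ] H) (f h : H) (τ : ℂ) :
    inner ℂ (f + τ • h) (B (f + τ • h)) =
      inner ℂ f (B f) + τ * inner ℂ f (B h) + conj τ * inner ℂ h (B f)
        + τ * conj τ * inner ℂ h (B h) := by
  simp only [map_add, map_smul, inner_add_left, inner_add_right, inner_smul_left,
    inner_smul_right]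
  ring

theorem inner_self_apply_real_smul (B : H →L[ℂ] H) (c : ℝ) (f : H) :
    inner ℂ ((c : ℂ) • f) (B ((c : ℂ) • f)) = (c : ℂ) ^ 2 * inner ℂ f (B f) := by
  simp only [map_smul, inner_smul_left, inner_smul_right, Complex.conj_ofReal]
  ring

theorem div_norm_sq_mem_numericalRange (B : H →L[ℂ] H) {f : H} (hf : f ≠ 0) :
    inner ℂ f (B f) / (‖f‖ : ℂ) ^ 2 ∈ numericalRange B := by
  have h0 : (‖f‖ : ℂ) ≠ 0 := by exact_mod_cast norm_ne_zero_iff.2 hf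
  refine ⟨((‖f‖⁻¹ : ℝ) : ℂ) • f, ?_, ?_⟩
  · simpa using norm_smul_inv_norm (𝕜 := ℂ) hf
  · rw [inner_self_apply_real_smul]
    push_cast
    field_simp

theorem smul_sub_mem_numericalRange (A : H →L[ℂ] H) {γ : ℂ} (hγ : γ ≠ 0) (p z : ℂ) :
    γ * (z - p) ∈ numericalRange (γ • (A - p • ContinuousLinearMap.id ℂ H)) ↔
      z ∈ numericalRange A := by
  refine exists_congr fun f => and_congr_right fun hf => ?_
  have : inner ℂ f ((γ • (A - p • ContinuousLinearMap.id ℂ H)) f)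
      = γ * (inner ℂ f (A f) - p) := by
    simp [inner_self_eq_norm_sq_to_K, hf]
  rw [this, mul_right_inj' hγ, sub_left_inj]

/-- The normalized case of the Toeplitz–Hausdorff theorem. After changing `g` by a phase that makes
the cross term of the quadratic form real, the form takes real values on the real segment from `f`
to `g`, and the intermediate value theorem applies. -/
theorem ofReal_mem_numericalRange_of_zero_one (B : H →L[ℂ] H) (h0 : 0 ∈ numericalRange B)
    (h1 : 1 ∈ numericalRange B) {t : ℝ} (ht : t ∈ Set.Icc (0 : ℝ) 1) :
    (t : ℂ) ∈ numericalRange B := by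
  obtain ⟨f, hf, hBf⟩ := h0
  obtain ⟨g, hg, hBg⟩ := h1
  obtain ⟨e, he, hre⟩ : ∃ e : ℂ, ‖e‖ = 1 ∧
      (e * inner ℂ f (B g) + conj e * inner ℂ g (B f)).im = 0 := by
    set d : ℂ := inner ℂ f (B g) - conj (inner ℂ g (B f)) with hd
    have key : ∀ e : ℂ, (e * inner ℂ f (B g) + conj e * inner ℂ g (B f)).im = (e * d).im := by
      intro e
      simp only [hd, mul_sub, Complex.add_im, Complex.sub_im, Complex.mul_im, Complex.conj_re,
        Complex.conj_im]
      ring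
    by_cases hd0 : d = 0
    · exact ⟨1, by simp, by rw [key, hd0]; simp⟩
    · refine ⟨conj d / (‖d‖ : ℂ), ?_, ?_⟩
      · simp [hd0]
      · rw [key, div_mul_eq_mul_div, Complex.conj_mul', ← Complex.ofReal_pow,
          ← Complex.ofReal_div, Complex.ofReal_im]
  set k : ℂ := e * inner ℂ f (B g) + conj e * inner ℂ g (B f) with hk
  have he2 : e * conj e = 1 := by rw [Complex.mul_conj', he]; simp
  let v : ℝ → H := fun s => ((1 - s : ℝ) : ℂ) • f + ((s : ℂ) * e) • g
  have hv : ∀ s : ℝ, inner ℂ (v s) (B (v s)) = (((1 - s) * s * k.re + s ^ 2 : ℝ) : ℂ) := by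
    intro s
    have hkr : k = (k.re : ℂ) := by
      apply Complex.ext <;> simp [hre]
    have h2 : inner ℂ (v s) (B (v s)) = ((1 - s) * s * k + s ^ 2 * (e * conj e) : ℂ) := by
      simp only [v]
      rw [inner_self_apply_add_smul, inner_self_apply_real_smul, ← hBf, ← hBg]
      simp only [map_smul, map_mul, inner_smul_left, inner_smul_right, Complex.conj_ofReal, hk]
      push_cast
      ring
    rw [h2, he2]
    push_cast
    rw [← hkr]
    ring
  have hv0 : ∀ s, v s ≠ 0 := by
    intro s hs
    have h3 : ((1 - s : ℝ) : ℂ) • f = (-((s : ℂ) * e)) • g := by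
      rw [neg_smul]; exact eq_neg_of_add_eq_zero_left hs
    have h4 := congrArg (fun w => inner ℂ w (B w)) h3
    simp only [map_smul, inner_smul_left, inner_smul_right, ← hBf, ← hBg] at h4
    have h5 : (s : ℂ) * e = 0 := by simpa using h4
    have hs0 : s = 0 := by
      rcases mul_eq_zero.1 h5 with h | h
      · exact_mod_cast h
      · rw [h] at he; simp at he
    have : f = 0 := by simpa [v, hs0] using hs
    simp [this] at hf
  have hvc : Continuous v := by fun_prop
  let φ : ℝ → ℝ := fun s => ((1 - s) * s * k.re + s ^ 2) / ‖v s‖ ^ 2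
  have hφc : Continuous φ := by
    refine Continuous.div (by fun_prop) (by fun_prop) fun s => ?_
    exact pow_ne_zero _ (norm_ne_zero_iff.2 (hv0 s))
  have hφ0 : φ 0 = 0 := by simp [φ]
  have hφ1 : φ 1 = 1 := by simp [φ, v, norm_smul, he, hg]
  have := intermediate_value_Icc (zero_le_one' ℝ) hφc.continuousOn
  rw [hφ0, hφ1] at this
  obtain ⟨s, -, hs⟩ := this ht
  have hmem := div_norm_sq_mem_numericalRange B (hv0 s)
  rw [hv s, ← Complex.ofReal_pow, ← Complex.ofReal_div] at hmem
  rw [← hs]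
  exact hmem

/-- The Toeplitz–Hausdorff theorem. -/
theorem convex_numericalRange (A : H →L[ℂ] H) : Convex ℝ (numericalRange A) := by
  rw [convex_iff_segment_subset]
  intro a ha b hb
  rcases eq_or_ne a b with rfl | hab
  · simpa using ha
  rw [segment_eq_image']
  rintro _ ⟨t, ht, rfl⟩
  have hba : b - a ≠ 0 := sub_ne_zero.2 hab.symm
  have hγ : (b - a)⁻¹ ≠ 0 := inv_ne_zero hba
  rw [← smul_sub_mem_numericalRange A hγ a]
  have h0 := (smul_sub_mem_numericalRange A hγ a a).2 ha
  have h1 := (smul_sub_mem_numericalRange A hγ a b).2 hb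
  rw [sub_self, mul_zero] at h0
  rw [inv_mul_cancel₀ hba] at h1
  convert ofReal_mem_numericalRange_of_zero_one _ h0 h1 ht using 1
  simp only [Complex.real_smul]
  field_simp
  ring

end NumericalRange

/-! ### Convex sets in the plane -/

section PlaneGeometry

/-- In finite dimension, a convex set and its closure have the same interior, also when that
interior is empty: an open subset of the closure forces the affine span to be the whole space. -/
theorem Convex.interior_closure_eq_interior_of_finiteDimensional {E : Type*}
    [NormedAddCommGroup E] [NormedSpace ℝ E] [FiniteDimensional ℝ E] {s : Set E}
    (hs : Convex ℝ s) : interior (closure s) = interior s := by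
  rcases (interior (closure s)).eq_empty_or_nonempty with h | h
  · rw [h]
    exact (Set.subset_empty_iff.1 (h ▸ interior_mono subset_closure)).symm
  · refine hs.interior_closure_eq_interior_of_nonempty_interior ?_
    rw [hs.interior_nonempty_iff_affineSpan_eq_top]
    have hcl : closure s ⊆ (affineSpan ℝ s : Set E) :=
      closure_minimal (subset_affineSpan ℝ s)
        (AffineSubspace.closed_of_finiteDimensional (affineSpan ℝ s))
    have h1 := isOpen_interior.affineSpan_eq_top h
    rw [eq_top_iff, ← h1]
    exact affineSpan_le.2 (interior_subset.trans hcl)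

theorem exists_eq_re_im_of_strongDual (l : StrongDual ℝ ℂ) :
    ∃ a b : ℝ, ∀ v : ℂ, l v = a * v.re + b * v.im := by
  refine ⟨l 1, l Complex.I, fun v => ?_⟩
  conv_lhs => rw [← Complex.re_add_im v]
  have h1 : (v.re : ℂ) = v.re • (1 : ℂ) := by simp
  have h2 : (v.im : ℂ) * Complex.I = v.im • Complex.I := by simp
  rw [h1, h2, map_add, map_smul, map_smul]
  simp [mul_comm]

/-- A convex set `Ω` in the closed upper half-plane, adherent to `0` and containing near `0` points
below a parabola on both sides, has its boundary near `0` below that parabola. A line separating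
`closure Ω` from a point `w` above the parabola would have `Ω` below it; as `closure Ω` has points
on or above the real axis on both sides of `0`, the line would have small height and slope when `w`
is close to `0`, so it could not lie above a fixed `Q` with `0 < Q.im`. Hence the region above the
parabola is interior to `Ω`. -/
theorem eventually_frontier_im_div_le {Ω : Set ℂ} (hΩ : Convex ℝ Ω) (hpos : ∀ v ∈ Ω, 0 ≤ v.im)
    (h0 : (0 : ℂ) ∈ closure Ω) {C s₀ : ℝ} (hC : 0 ≤ C) (hs₀ : 0 < s₀)
    (hpar : ∀ s : ℝ, s ≠ 0 → |s| ≤ s₀ → ∃ v ∈ Ω, 1 ≤ v.re / s ∧ v.im ≤ C * s ^ 2) :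
    ∀ᶠ w in 𝓝[{w : ℂ | w.re ≠ 0 ∧ w ∈ frontier Ω}] 0, w.im / w.re ^ 2 ≤ C := by
  have hposc : ∀ v ∈ closure Ω, 0 ≤ v.im := fun v hv =>
    closure_minimal (t := {v : ℂ | 0 ≤ v.im}) hpos
      (isClosed_le continuous_const Complex.continuous_im) hv
  have hcc : Convex ℝ (closure Ω) := hΩ.closure
  -- interpolating with the adherent point `0` makes the abscissa exact
  have hparc : ∀ s : ℝ, s ≠ 0 → |s| ≤ s₀ → ∃ v ∈ closure Ω, v.re = s ∧ v.im ≤ C * s ^ 2 := by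
    intro s hs hss
    obtain ⟨v, hv, h1, h2⟩ := hpar s hs hss
    have hr : 0 ≤ (v.re / s)⁻¹ := by positivity
    have hr1 : (v.re / s)⁻¹ ≤ 1 := inv_le_one_of_one_le₀ h1
    refine ⟨(v.re / s)⁻¹ • v, hcc.smul_mem_of_zero_mem h0 (subset_closure hv) ⟨hr, hr1⟩, ?_, ?_⟩
    · have hvre : v.re ≠ 0 := by
        intro h; rw [h] at h1; norm_num at h1
      rw [Complex.smul_re, smul_eq_mul, inv_div, div_mul_cancel₀ _ hvre]
    · rw [Complex.smul_im, smul_eq_mul]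
      nlinarith [hpos v hv]
  by_cases hQ : ∃ Q ∈ closure Ω, 0 < Q.im
  swap
  · push Not at hQ
    filter_upwards [self_mem_nhdsWithin] with w hw
    have := hQ w (frontier_subset_closure hw.2)
    exact (div_nonpos_of_nonpos_of_nonneg this (sq_nonneg _)).trans hC
  obtain ⟨Q, hQ, hQim⟩ := hQ
  obtain ⟨P, hP, hPre, -⟩ := hparc s₀ hs₀.ne' (abs_of_pos hs₀).le
  obtain ⟨N, hN, hNre, -⟩ := hparc (-s₀) (neg_ne_zero.2 hs₀.ne')
    (by rw [abs_neg, abs_of_pos hs₀])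
  set R : ℝ := Q.im / (2 + 2 * (|Q.re| + s₀) / s₀) with hR
  have hden : 0 < 2 + 2 * (|Q.re| + s₀) / s₀ := by positivity
  have hRpos : 0 < R := div_pos hQim hden
  have hRmul : R * (2 + 2 * (|Q.re| + s₀) / s₀) = Q.im := div_mul_cancel₀ _ hden.ne'
  -- the region above the parabola and close to `0` is contained in the closure of `Ω`
  let U : Set ℂ := {w | w.re ≠ 0 ∧ |w.re| < s₀ / 2 ∧ w.im < R ∧ C * w.re ^ 2 < w.im}
  have hUopen : IsOpen U := by
    have c1 := Complex.continuous_re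
    have c2 := Complex.continuous_im
    exact (isOpen_ne_fun c1 continuous_const).inter
      ((isOpen_lt c1.abs continuous_const).inter
        ((isOpen_lt c2 continuous_const).inter
          (isOpen_lt (continuous_const.mul (c1.pow 2)) c2)))
  have hUsub : U ⊆ closure Ω := by
    rintro w ⟨hw0, hw1, hw2, hw3⟩
    by_contra hw
    obtain ⟨l, c, hlw, hl⟩ := geometric_hahn_banach_point_closed hcc isClosed_closure hw
    obtain ⟨a, b, hab⟩ := exists_eq_re_im_of_strongDual l
    have hlt : ∀ v ∈ closure Ω, a * w.re + b * w.im < a * v.re + b * v.im := fun v hv => by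
      rw [← hab, ← hab]; exact hlw.trans (hl v hv)
    obtain ⟨V, hV, hVre, hVim⟩ := hparc w.re hw0 (by linarith)
    have hb : b < 0 := by
      have := hlt V hV
      rw [hVre] at this
      by_contra hb
      nlinarith
    have e1 := hlt P hP
    have e2 := hlt N hN
    have e3 := hlt Q hQ
    have p1 := mul_nonneg (neg_nonneg.2 hb.le) (hposc P hP)
    have p2 := mul_nonneg (neg_nonneg.2 hb.le) (hposc N hN)
    rw [hPre] at e1
    rw [hNre] at e2
    have hax : |a * w.re| ≤ |a| * (s₀ / 2) := by
      rw [abs_mul]; exact mul_le_mul_of_nonneg_left hw1.le (abs_nonneg a)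
    have haQ : |a * Q.re| = |a| * |Q.re| := abs_mul _ _
    have f1 : |a| * s₀ ≤ |a * w.re| + (-b) * w.im := by
      rcases abs_cases a with ⟨h, -⟩ | ⟨h, -⟩ <;> rw [h] <;>
        nlinarith [neg_abs_le (a * w.re), le_abs_self (a * w.re)]
    have f2 : |a| ≤ 2 * ((-b) * w.im) / s₀ := by
      rw [le_div_iff₀ hs₀]; linarith
    have f3 : (-b) * Q.im ≤ |a| * (|Q.re| + s₀) + (-b) * w.im := by
      have := le_abs_self (a * Q.re)
      have := neg_abs_le (a * w.re)
      nlinarith [abs_nonneg a]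
    have f4 : (-b) * Q.im ≤ 2 * ((-b) * w.im) / s₀ * (|Q.re| + s₀) + (-b) * w.im :=
      f3.trans (by gcongr)
    have f5 : 2 * ((-b) * w.im) / s₀ * (|Q.re| + s₀) + (-b) * w.im
        = (-b) * (w.im * (1 + 2 * (|Q.re| + s₀) / s₀)) := by ring
    rw [f5] at f4
    have f6 : Q.im ≤ w.im * (1 + 2 * (|Q.re| + s₀) / s₀) :=
      le_of_mul_le_mul_left f4 (neg_pos.2 hb)
    have f7 : w.im * (1 + 2 * (|Q.re| + s₀) / s₀) ≤ R * (1 + 2 * (|Q.re| + s₀) / s₀) := by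
      gcongr
    nlinarith
  have hre : ∀ᶠ w : ℂ in 𝓝 0, |w.re| < s₀ / 2 :=
    (show Continuous fun w : ℂ => |w.re| by fun_prop).tendsto' 0 0 (by simp) |>.eventually
      (gt_mem_nhds (by positivity))
  have him : ∀ᶠ w : ℂ in 𝓝 0, w.im < R :=
    Complex.continuous_im.tendsto' 0 0 (by simp) |>.eventually (gt_mem_nhds hRpos)
  filter_upwards [self_mem_nhdsWithin, nhdsWithin_le_nhds hre, nhdsWithin_le_nhds him]
    with w hw hw1 hw2
  by_contra! hlt
  rw [lt_div_iff₀ (by have := hw.1; positivity)] at hlt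
  have hint : w ∈ interior (closure Ω) :=
    interior_maximal hUsub hUopen ⟨hw.1, hw1, hw2, hlt⟩
  rw [hΩ.interior_closure_eq_interior_of_finiteDimensional] at hint
  exact hw.2.2 hint

/-- A set contained in a proper circular cone `c ‖v - p‖ ≤ ⟪m, v - p⟫` with vertex `p` has `p` as a
corner point. For `m = 0` the cone is the single point `p`. -/
theorem isCornerPoint_of_cone {Ω : Set ℂ} {p m : ℂ} {c : ℝ} (hc : 0 < c)
    (h : ∀ v ∈ Ω, c * ‖v - p‖ ≤ (conj m * (v - p)).re) : IsCornerPoint Ω p := by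
  rcases eq_or_ne m 0 with rfl | hm
  · refine ⟨0, 0, le_rfl, by simpa using Real.pi_pos,
      fun v hv => ⟨0, 0, by simp, by simp, by simp, ?_⟩⟩
    have h1 := h v hv
    have h2 : ‖v - p‖ ≤ 0 := by
      simp only [map_zero, zero_mul, Complex.zero_re] at h1
      nlinarith [norm_nonneg (v - p)]
    simpa [sub_eq_zero] using h2
  have hm' : 0 < ‖m‖ := norm_pos_iff.2 hm
  set κ := Real.arccos (c / ‖m‖) with hκ
  have hκ2 : κ < Real.pi / 2 := Real.arccos_lt_pi_div_two.2 (by positivity)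
  have hκ0 : 0 ≤ κ := Real.arccos_nonneg _
  refine ⟨m.arg - κ, m.arg + κ, by linarith, by linarith, fun v hv => ?_⟩
  have h1 := h v hv
  set x := v - p with hx
  rcases eq_or_ne x 0 with hx0 | hx0
  · exact ⟨0, m.arg, le_rfl, by linarith, by linarith, by
      rw [sub_eq_zero] at hx0; simp [hx0]⟩
  have hxn : 0 < ‖x‖ := norm_pos_iff.2 hx0
  have hψ : |(conj m * x).arg| ≤ κ := by
    rw [← Real.arccos_cos (abs_nonneg _) (Complex.abs_arg_le_pi _), hκ, Real.cos_abs]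
    apply Real.arccos_le_arccos
    rw [Complex.cos_arg (mul_ne_zero ((map_ne_zero _).2 hm) hx0), norm_mul, Complex.norm_conj,
      div_le_div_iff₀ hm' (by positivity)]
    nlinarith
  refine ⟨‖x‖, m.arg + (conj m * x).arg, hxn.le, by linarith [(abs_le.1 hψ).1],
    by linarith [(abs_le.1 hψ).2], ?_⟩
  have e1 := Complex.norm_mul_exp_arg_mul_I m
  have e2 := Complex.norm_mul_exp_arg_mul_I (conj m * x)
  have hmc : (‖m‖ : ℂ) ≠ 0 := by exact_mod_cast hm'.ne'
  have e3 : (‖m‖ : ℂ) ^ 2 * (‖x‖ * Complex.exp (((m.arg + (conj m * x).arg : ℝ) : ℂ) * Complex.I))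
      = (‖m‖ : ℂ) ^ 2 * x := by
    calc _ = (‖m‖ * Complex.exp (m.arg * Complex.I)) *
          (‖conj m * x‖ * Complex.exp ((conj m * x).arg * Complex.I)) := by
            rw [norm_mul, Complex.norm_conj]
            push_cast
            rw [add_mul, Complex.exp_add]
            ring
      _ = m * conj m * x := by rw [e1, e2, mul_assoc]
      _ = _ := by rw [Complex.mul_conj']
  rw [mul_left_cancel₀ (pow_ne_zero 2 hmc) e3, hx]
  ring

end PlaneGeometry

/-! ### Operators with positive semidefinite imaginary part -/

section DissipativeForm

variable {H : Type*} [NormedAddCommGroup H] [InnerProductSpace ℂ H]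

theorem norm_inner_self_apply_le (B : H →L[ℂ] H) (f : H) :
    ‖inner ℂ f (B f)‖ ≤ ‖B‖ * ‖f‖ ^ 2 :=
  calc ‖inner ℂ f (B f)‖ ≤ ‖f‖ * ‖B f‖ := norm_inner_le_norm _ _
    _ ≤ ‖f‖ * (‖B‖ * ‖f‖) := by gcongr; exact B.le_opNorm f
    _ = _ := by ring

/-- The Cauchy–Schwarz inequality for the positive semidefinite form
`(⟪f, B h⟫ - conj ⟪h, B f⟫) / 2i`, the imaginary part of `B`. -/
theorem norm_sq_inner_sub_conj_le {B : H →L[ℂ] H} (hB : ∀ f : H, 0 ≤ (inner ℂ f (B f)).im)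
    (f h : H) :
    ‖inner ℂ f (B h) - conj (inner ℂ h (B f))‖ ^ 2 ≤
      4 * (inner ℂ f (B f)).im * (inner ℂ h (B h)).im := by
  set d : ℂ := inner ℂ f (B h) - conj (inner ℂ h (B f)) with hd
  have key : ∀ t : ℝ, 0 ≤ (‖d‖ ^ 2 * (inner ℂ h (B h)).im) * (t * t) + ‖d‖ ^ 2 * t
      + (inner ℂ f (B f)).im := by
    intro t
    have h1 := hB (f + (t * (Complex.I * conj d)) • h)
    rw [inner_self_apply_add_smul] at h1
    have h2 : ((t * (Complex.I * conj d)) * conj (t * (Complex.I * conj d)) : ℂ)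
        = ((t ^ 2 * ‖d‖ ^ 2 : ℝ) : ℂ) := by
      rw [Complex.mul_conj']
      simp only [norm_mul, Complex.norm_real, Complex.norm_I, Complex.norm_conj, one_mul,
        Real.norm_eq_abs]
      rw [← Complex.ofReal_pow, mul_pow, sq_abs]
    have h3 : ∀ τ a b : ℂ, (τ * a + conj τ * b).im = (τ * (a - conj b)).im := by
      intro τ a b
      simp only [mul_sub, Complex.add_im, Complex.sub_im, Complex.mul_im, Complex.conj_re,
        Complex.conj_im]
      ring
    have h4 : (t * (Complex.I * conj d) * d : ℂ) = ((t * ‖d‖ ^ 2 : ℝ) : ℂ) * Complex.I := by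
      rw [mul_assoc, mul_assoc, Complex.conj_mul']
      push_cast
      ring
    rw [h2, add_assoc (inner ℂ f (B f)), Complex.add_im, Complex.add_im, h3, ← hd, h4,
      Complex.im_ofReal_mul, Complex.im_ofReal_mul, Complex.I_im] at h1
    linarith
  have h5 := discrim_le_zero key
  rw [discrim] at h5
  rcases eq_or_ne d 0 with h0 | h0
  · rw [h0]
    rw [norm_zero, zero_pow two_ne_zero]
    exact mul_nonneg (mul_nonneg (by norm_num) (hB f)) (hB h)
  · have h6 : 0 < ‖d‖ ^ 2 := by have := norm_pos_iff.2 h0; positivity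
    nlinarith

/-- A kernel vector of `B` also annihilates the imaginary part of `B`, hence lies in the kernel of
the adjoint; therefore it does not contribute to the quadratic form. -/
theorem inner_self_apply_add_of_mem_ker {B : H →L[ℂ] H}
    (hB : ∀ f : H, 0 ≤ (inner ℂ f (B f)).im) {k : H} (hk : B k = 0) (g : H) :
    inner ℂ (k + g) (B (k + g)) = inner ℂ g (B g) := by
  have h1 := norm_sq_inner_sub_conj_le hB k g
  rw [hk, inner_zero_right, inner_zero_right] at h1
  have h2 : inner ℂ k (B g) = 0 := by
    simpa using h1
  rw [map_add, hk, zero_add, inner_add_left, h2, zero_add]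

/-- Either `0` is separated from the quadratic form of `B` on the unit sphere of `(ker B)ᗮ`, and
then the numerical range is contained in a proper cone, or `0` is adherent to the values of that
form. -/
theorem numericalRange_subset_cone_or_exists_small [CompleteSpace H] {B : H →L[ℂ] H}
    (hB : ∀ f : H, 0 ≤ (inner ℂ f (B f)).im) :
    (∃ (m : ℂ) (c : ℝ), 0 < c ∧ ∀ v ∈ numericalRange B, c * ‖v‖ ≤ (conj m * v).re) ∨
      ∀ ε : ℝ, 0 < ε → ∃ f ∈ (B.ker)ᗮ, ‖f‖ = 1 ∧ ‖inner ℂ f (B f)‖ < ε := by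
  by_cases hsmall : ∀ ε : ℝ, 0 < ε → ∃ f ∈ (B.ker)ᗮ, ‖f‖ = 1 ∧ ‖inner ℂ f (B f)‖ < ε
  · exact Or.inr hsmall
  left
  push Not at hsmall
  obtain ⟨ε, hε, hfar⟩ := hsmall
  have : CompleteSpace B.ker := B.isClosed_ker.completeSpace_coe
  let K : Submodule ℂ H := (B.ker)ᗮ
  -- the compression of `B` to `(ker B)ᗮ`
  let BK : K →L[ℂ] K := K.orthogonalProjectionOnto ∘L B ∘L K.subtypeL
  have hBK : ∀ f : K, inner ℂ f (BK f) = inner ℂ (f : H) (B f) := fun f => by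
    simp only [BK, ContinuousLinearMap.comp_apply]
    rw [Submodule.inner_orthogonalProjectionOnto_eq_of_mem_left]
    rfl
  have h0 : (0 : ℂ) ∉ closure (numericalRange BK) := by
    rw [Metric.mem_closure_iff]
    push Not
    refine ⟨ε, hε, ?_⟩
    rintro _ ⟨f, hf, rfl⟩
    rw [hBK, dist_zero_left]
    exact hfar f f.2 (by simpa using hf)
  obtain ⟨l, c, hl0, hl⟩ := geometric_hahn_banach_point_closed (convex_numericalRange BK).closure
    isClosed_closure h0
  rw [map_zero] at hl0
  obtain ⟨a, b, hab⟩ := exists_eq_re_im_of_strongDual l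
  refine ⟨⟨a, b⟩, c / (‖B‖ + 1), by positivity, ?_⟩
  rintro _ ⟨f, hf, rfl⟩
  have hlv : ∀ v : ℂ, (conj (⟨a, b⟩ : ℂ) * v).re = l v := fun v => by
    rw [hab]; simp
  obtain ⟨k, hk, g, hg, rfl⟩ := Submodule.exists_add_mem_mem_orthogonal (K := B.ker) f
  rw [inner_self_apply_add_of_mem_ker hB hk, hlv]
  rcases eq_or_ne g 0 with rfl | hg0
  · simp
  have hgn : 0 < ‖g‖ := norm_pos_iff.2 hg0
  have hmem := div_norm_sq_mem_numericalRange BK (f := ⟨g, hg⟩)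
    (by simpa [Subtype.ext_iff] using hg0)
  rw [hBK] at hmem
  have h1 := hl _ (subset_closure hmem)
  have h2 : (inner ℂ g (B g) / (‖g‖ : ℂ) ^ 2) = (‖g‖ ^ 2)⁻¹ • inner ℂ g (B g) := by
    rw [Complex.real_smul]; push_cast; field_simp
  change c < l (inner ℂ g (B g) / (‖g‖ : ℂ) ^ 2) at h1
  rw [h2, map_smul, smul_eq_mul, ← div_eq_inv_mul, lt_div_iff₀ (by positivity)] at h1
  have h3 := norm_inner_self_apply_le B g
  have h4 := norm_nonneg B
  calc c / (‖B‖ + 1) * ‖inner ℂ g (B g)‖ ≤ c / (‖B‖ + 1) * (‖B‖ * ‖g‖ ^ 2) := by gcongr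
    _ = c * ‖g‖ ^ 2 * (‖B‖ / (‖B‖ + 1)) := by ring
    _ ≤ c * ‖g‖ ^ 2 * 1 := by
      gcongr
      rw [div_le_one (by positivity)]
      linarith
    _ ≤ _ := by linarith

/-- Moving a unit vector `f` with small `⟪f, B f⟫` to `f + t • B f` moves the value of the
quadratic form by about `2 t ‖B f‖ ^ 2` in the real direction and by `O(t ^ 2)` in the imaginary
direction, since the imaginary part of `B` nearly annihilates `f`. -/
theorem exists_perturbation_below_parabola {B : H →L[ℂ] H}
    (hB : ∀ f : H, 0 ≤ (inner ℂ f (B f)).im) {δ : ℝ} (hδ : 0 < δ)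
    (hsmall : ∀ ε : ℝ, 0 < ε → ∃ f : H, ‖f‖ = 1 ∧ δ ≤ ‖B f‖ ∧ ‖inner ℂ f (B f)‖ < ε) :
    ∃ C τ : ℝ, 0 ≤ C ∧ 0 < τ ∧ ∀ t : ℝ, t ≠ 0 → |t| ≤ τ →
      ∃ g : H, 1 / 2 ≤ ‖g‖ ∧ ‖g‖ ≤ 2 ∧ t ^ 2 * δ ^ 2 ≤ t * (inner ℂ g (B g)).re ∧
        (inner ℂ g (B g)).im ≤ C * t ^ 2 := by
  set M : ℝ := ‖B‖ + 1 with hM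
  have hM0 : 0 < M := by positivity
  have hBM : ‖B‖ ≤ M := by linarith
  set τ : ℝ := min (1 / (2 * M)) (δ ^ 2 / (4 * M ^ 3)) with hτ
  have hτ0 : 0 < τ := by positivity
  refine ⟨2 + M ^ 3, τ, by positivity, hτ0, fun t ht0 htτ => ?_⟩
  have hta : 0 < |t| := abs_pos.2 ht0
  have htM : |t| * M ≤ 1 / 2 := by
    have := htτ.trans (min_le_left _ _)
    rw [le_div_iff₀ (by positivity)] at this
    linarith
  have htM3 : |t| * M ^ 3 ≤ δ ^ 2 / 4 := by
    have := htτ.trans (min_le_right _ _)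
    rw [le_div_iff₀ (by positivity)] at this
    linarith
  -- `η` bounds the cross term `D` below, both against `δ ^ 2` and against `|t|`; by Cauchy–Schwarz
  -- this costs `⟪f, B f⟫` of order `η ^ 2`
  set η : ℝ := min (δ ^ 2 / 4) |t| with hη
  have hη0 : 0 < η := by positivity
  obtain ⟨f, hf, hfδ, hfε⟩ := hsmall (min (|t| * η) (η ^ 2 / (4 * M ^ 3))) (by positivity)
  have hq1 : ‖inner ℂ f (B f)‖ ≤ |t| * η := hfε.le.trans (min_le_left _ _)
  have hq2 : ‖inner ℂ f (B f)‖ * (4 * M ^ 3) ≤ η ^ 2 := by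
    rw [← le_div_iff₀ (by positivity)]
    exact hfε.le.trans (min_le_right _ _)
  set h : H := B f with hh
  have hhM : ‖h‖ ≤ M := by
    have := B.le_opNorm f
    rw [hf, mul_one] at this
    exact this.trans hBM
  have hqh : ‖inner ℂ h (B h)‖ ≤ M ^ 3 := by
    calc ‖inner ℂ h (B h)‖ ≤ ‖B‖ * ‖h‖ ^ 2 := norm_inner_self_apply_le B h
      _ ≤ M * M ^ 2 := by gcongr
      _ = M ^ 3 := by ring
  set D : ℂ := inner ℂ f (B h) - conj (inner ℂ h (B f)) with hD
  have hDη : ‖D‖ ≤ η := by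
    refine le_of_sq_le_sq ?_ hη0.le
    calc ‖D‖ ^ 2 ≤ 4 * (inner ℂ f (B f)).im * (inner ℂ h (B h)).im :=
          norm_sq_inner_sub_conj_le hB f h
      _ ≤ 4 * ‖inner ℂ f (B f)‖ * M ^ 3 := by
          have := hB f
          have := hB h
          gcongr
          · exact (le_abs_self _).trans (Complex.abs_im_le_norm _)
          · exact ((le_abs_self _).trans (Complex.abs_im_le_norm _)).trans hqh
      _ ≤ η ^ 2 := by linarith
  set g : H := f + (t : ℂ) • h with hg
  have hqg : inner ℂ g (B g) = inner ℂ f (B f) + (t : ℂ) * D + ((2 * t * ‖h‖ ^ 2 : ℝ) : ℂ)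
      + ((t ^ 2 : ℝ) : ℂ) * inner ℂ h (B h) := by
    have h1 : inner ℂ h (B f) = ((‖h‖ ^ 2 : ℝ) : ℂ) := by
      rw [← hh, inner_self_eq_norm_sq_to_K]; norm_cast
    rw [hg, inner_self_apply_add_smul, hD, h1, Complex.conj_ofReal, Complex.conj_ofReal]
    push_cast
    ring
  have hgt : ‖(t : ℂ) • h‖ ≤ 1 / 2 := by
    rw [norm_smul, Complex.norm_real, Real.norm_eq_abs]
    exact (mul_le_mul_of_nonneg_left hhM hta.le).trans htM
  have hg1 : ‖g‖ ≤ 2 := by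
    have := norm_add_le f ((t : ℂ) • h)
    linarith
  have hg2 : 1 / 2 ≤ ‖g‖ := by
    have := norm_sub_norm_le f (-((t : ℂ) • h))
    rw [norm_neg, sub_neg_eq_add, ← hg] at this
    linarith
  have hgpos : 0 < ‖g‖ := by linarith
  have hηδ : η ≤ δ ^ 2 / 4 := min_le_left _ _
  have hηt : η ≤ |t| := min_le_right _ _
  have habs : |t| * |t| = t ^ 2 := by rw [abs_mul_abs_self, sq]
  have hδh : δ ^ 2 ≤ ‖h‖ ^ 2 := by gcongr
  have ht2 : 0 < t ^ 2 := by positivity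
  have hre : t ^ 2 * δ ^ 2 ≤ t * (inner ℂ g (B g)).re := by
    have e1 : t * (inner ℂ g (B g)).re = t * (inner ℂ f (B f)).re + t ^ 2 * D.re
        + 2 * t ^ 2 * ‖h‖ ^ 2 + t ^ 2 * (t * (inner ℂ h (B h)).re) := by
      rw [hqg]
      simp only [Complex.add_re, Complex.re_ofReal_mul, Complex.ofReal_re]
      ring
    have b1 : |t * (inner ℂ f (B f)).re| ≤ t ^ 2 * η := by
      rw [abs_mul, ← habs, mul_assoc]
      gcongr
      exact (Complex.abs_re_le_norm _).trans hq1
    have b2 : |D.re| ≤ η := (Complex.abs_re_le_norm _).trans hDη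
    have b3 : |t * (inner ℂ h (B h)).re| ≤ δ ^ 2 / 4 := by
      rw [abs_mul]
      refine le_trans ?_ htM3
      gcongr
      exact (Complex.abs_re_le_norm _).trans hqh
    rw [e1]
    have c2 := mul_le_mul_of_nonneg_left ((neg_le_neg b2).trans (neg_abs_le _)) ht2.le
    have c3 := mul_le_mul_of_nonneg_left ((neg_le_neg b3).trans (neg_abs_le _)) ht2.le
    have c4 := mul_le_mul_of_nonneg_left hδh ht2.le
    have c5 := mul_le_mul_of_nonneg_left hηδ ht2.le
    have c6 := neg_abs_le (t * (inner ℂ f (B f)).re)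
    nlinarith
  have him : (inner ℂ g (B g)).im ≤ (2 + M ^ 3) * t ^ 2 := by
    have e1 : (inner ℂ g (B g)).im = (inner ℂ f (B f)).im + t * D.im
        + t ^ 2 * (inner ℂ h (B h)).im := by
      rw [hqg]
      simp only [Complex.add_im, Complex.im_ofReal_mul, Complex.ofReal_im]
      ring
    have b1 : (inner ℂ f (B f)).im ≤ t ^ 2 := by
      rw [← habs]
      exact ((le_abs_self _).trans (Complex.abs_im_le_norm _)).trans (hq1.trans (by gcongr))
    have b2 : t * D.im ≤ t ^ 2 := by
      rw [← habs]
      refine (le_abs_self _).trans ?_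
      rw [abs_mul]
      exact mul_le_mul_of_nonneg_left ((Complex.abs_im_le_norm _).trans (hDη.trans hηt)) hta.le
    have b3 : t ^ 2 * (inner ℂ h (B h)).im ≤ t ^ 2 * M ^ 3 := by
      gcongr
      exact ((le_abs_self _).trans (Complex.abs_im_le_norm _)).trans hqh
    rw [e1]
    linarith
  exact ⟨g, hg2, hg1, hre, him⟩

theorem exists_mem_numericalRange_below_parabola {B : H →L[ℂ] H}
    (hB : ∀ f : H, 0 ≤ (inner ℂ f (B f)).im) {δ : ℝ} (hδ : 0 < δ)
    (hsmall : ∀ ε : ℝ, 0 < ε → ∃ f : H, ‖f‖ = 1 ∧ δ ≤ ‖B f‖ ∧ ‖inner ℂ f (B f)‖ < ε) :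
    ∃ C s₀ : ℝ, 0 ≤ C ∧ 0 < s₀ ∧ ∀ s : ℝ, s ≠ 0 → |s| ≤ s₀ →
      ∃ v ∈ numericalRange B, 1 ≤ v.re / s ∧ v.im ≤ C * s ^ 2 := by
  obtain ⟨C, τ, hC, hτ0, H⟩ := exists_perturbation_below_parabola hB hδ hsmall
  refine ⟨4 * C * (4 / δ ^ 2) ^ 2, τ * δ ^ 2 / 4, by positivity, by positivity,
    fun s hs hss => ?_⟩
  -- `t` is taken so large that `t * δ ^ 2` absorbs the bound `‖g‖ ^ 2 ≤ 4`
  obtain ⟨t, ht⟩ : ∃ t : ℝ, t = 4 / δ ^ 2 * s := ⟨_, rfl⟩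
  have ht0 : t ≠ 0 := by rw [ht]; positivity
  have htτ : |t| ≤ τ := by
    rw [ht, abs_mul, abs_of_pos (by positivity : 0 < 4 / δ ^ 2), div_mul_eq_mul_div,
      div_le_iff₀ (by positivity)]
    linarith
  obtain ⟨g, hg2, hg1, hre, him⟩ := H t ht0 htτ
  have hgpos : 0 < ‖g‖ := by linarith
  have hdiv : (inner ℂ g (B g) / (‖g‖ : ℂ) ^ 2) = (((‖g‖ ^ 2)⁻¹ : ℝ) : ℂ) * inner ℂ g (B g) := by
    push_cast; field_simp
  refine ⟨_, div_norm_sq_mem_numericalRange B (norm_pos_iff.1 hgpos), ?_, ?_⟩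
  · rw [hdiv, Complex.re_ofReal_mul]
    have e2 : (‖g‖ ^ 2)⁻¹ * (inner ℂ g (B g)).re / s
        = (s * (inner ℂ g (B g)).re) / (s ^ 2 * ‖g‖ ^ 2) := by
      field_simp
    rw [e2, le_div_iff₀ (by positivity), one_mul]
    have e3 : s = δ ^ 2 / 4 * t := by rw [ht]; field_simp
    have e4 : ‖g‖ ^ 2 ≤ 4 := by nlinarith
    calc s ^ 2 * ‖g‖ ^ 2 ≤ s ^ 2 * 4 := by gcongr
      _ = δ ^ 2 / 4 * (t ^ 2 * δ ^ 2) := by rw [e3]; ring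
      _ ≤ δ ^ 2 / 4 * (t * (inner ℂ g (B g)).re) := by gcongr
      _ = s * (inner ℂ g (B g)).re := by rw [e3]; ring
  · rw [hdiv, Complex.im_ofReal_mul]
    have e4 : (‖g‖ ^ 2)⁻¹ ≤ 4 := by
      rw [inv_le_comm₀ (by positivity) (by norm_num)]
      nlinarith
    calc (‖g‖ ^ 2)⁻¹ * (inner ℂ g (B g)).im ≤ 4 * (C * t ^ 2) :=
          mul_le_mul e4 him (hB g) (by norm_num)
      _ = _ := by rw [ht]; ring

end DissipativeForm

/-! ### Fredholm operators are bounded below off their kernel -/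

section Fredholm

/-- The restriction to `(ker T)ᗮ` is injective with the same closed range as `T`, so the open
mapping theorem applies. -/
theorem ContinuousLinearMap.IsFredholm.exists_le_norm_of_mem_ker_orthogonal {H : Type*}
    [NormedAddCommGroup H] [InnerProductSpace ℂ H] [CompleteSpace H] {T : H →L[ℂ] H}
    (hT : T.IsFredholm) :
    ∃ δ : ℝ, 0 < δ ∧ ∀ f ∈ (T.ker)ᗮ, δ * ‖f‖ ≤ ‖T f‖ := by
  have : CompleteSpace T.ker := T.isClosed_ker.completeSpace_coe
  let S : (T.ker)ᗮ →L[ℂ] H := T ∘L (T.ker)ᗮ.subtypeL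
  have hinj : Function.Injective S := by
    rw [injective_iff_map_eq_zero]
    rintro ⟨f, hf⟩ hSf
    have hfk : f ∈ T.ker := hSf
    exact Subtype.ext (inner_self_eq_zero.1 (Submodule.inner_right_of_mem_orthogonal hfk hf))
  have hrange : Set.range S = (T.range : Set H) := by
    ext y
    constructor
    · rintro ⟨f, rfl⟩
      exact ⟨f, rfl⟩
    · rintro ⟨x, rfl⟩
      obtain ⟨k, hk, g, hg, rfl⟩ := Submodule.exists_add_mem_mem_orthogonal (K := T.ker) x
      have hk' : T k = 0 := hk
      exact ⟨⟨g, hg⟩, by simp [S, hk']⟩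
  obtain ⟨κ, hκ⟩ := S.antilipschitz_of_injective_of_isClosed_range hinj
    (hrange ▸ hT.isClosed_range)
  refine ⟨((κ : ℝ) + 1)⁻¹, by positivity, fun f hf => ?_⟩
  have h1 : ‖f‖ ≤ κ * ‖T f‖ := by
    simpa [S] using hκ.le_mul_norm_sub ⟨f, hf⟩ 0
  rw [inv_mul_le_iff₀ (by positivity)]
  nlinarith [norm_nonneg (T f)]

end Fredholm

/-! ### Points of infinite curvature -/

theorem theorem3 {H : Type*} [NormedAddCommGroup H] [InnerProductSpace ℂ H] [CompleteSpace H]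
    (A : H →L[ℂ] H) (z : ℂ)
    (hz : z ∈ frontier (numericalRange A))
    (hcurv : IsInfiniteUpperCurvaturePoint (numericalRange A) z)
    (hcorner : ¬ IsCornerPoint (numericalRange A) z) :
    z ∈ essentialSpectrum A := by
  intro hfred
  obtain ⟨u, ⟨hu, hsupp⟩, hcurv⟩ := hcurv.resolve_left hcorner
  have hu0 : u ≠ 0 := by
    rintro rfl
    simp at hu
  have hcu : conj u ≠ 0 := (map_ne_zero _).2 hu0
  have huu : conj u * u = 1 := by rw [Complex.conj_mul', hu]; simp
  -- the operator in the coordinates in which `z` is the origin and the real axis is supporting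
  set B : H →L[ℂ] H := conj u • (A - z • ContinuousLinearMap.id ℂ H) with hBdef
  have hcoord : ∀ w : ℂ, z + u * w ∈ numericalRange A ↔ w ∈ numericalRange B := fun w => by
    rw [← smul_sub_mem_numericalRange A hcu z, add_sub_cancel_left, ← mul_assoc, huu, one_mul]
  have hpos : ∀ v ∈ numericalRange B, 0 ≤ v.im := fun v hv => by
    refine hsupp v.re v.im ?_
    rwa [Complex.re_add_im, hcoord]
  have hB : ∀ f : H, 0 ≤ (inner ℂ f (B f)).im := by
    intro f
    rcases eq_or_ne f 0 with rfl | hf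
    · simp
    have hfn : 0 < ‖f‖ := norm_pos_iff.2 hf
    have h1 := hpos _ (div_norm_sq_mem_numericalRange B hf)
    rw [← Complex.ofReal_pow, Complex.div_ofReal_im] at h1
    rwa [le_div_iff₀ (by positivity), zero_mul] at h1
  have hBT : ∀ f, B f = (-conj u) • (z • ContinuousLinearMap.id ℂ H - A) f := fun f => by
    simp only [hBdef, _root_.smul_apply, _root_.sub_apply]
    rw [neg_smul, ← smul_neg, neg_sub]
  have hker : B.ker = (z • ContinuousLinearMap.id ℂ H - A).ker := by
    ext f
    rw [LinearMap.mem_ker, LinearMap.mem_ker, ContinuousLinearMap.coe_coe,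
      ContinuousLinearMap.coe_coe, hBT, smul_eq_zero_iff_right (neg_ne_zero.2 hcu)]
  obtain ⟨δ, hδ, hbelow⟩ := hfred.exists_le_norm_of_mem_ker_orthogonal
  rcases numericalRange_subset_cone_or_exists_small hB with ⟨m, c, hc, hcone⟩ | hsmall
  · refine hcorner (isCornerPoint_of_cone (m := u * m) hc fun v hv => ?_)
    have h1 := hcone _ ((smul_sub_mem_numericalRange A hcu z v).2 hv)
    rw [norm_mul, Complex.norm_conj, hu, one_mul] at h1
    rw [map_mul, mul_comm (conj u), mul_assoc]
    exact h1
  · have hsmall' : ∀ ε : ℝ, 0 < ε →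
        ∃ f : H, ‖f‖ = 1 ∧ δ ≤ ‖B f‖ ∧ ‖inner ℂ f (B f)‖ < ε := by
      intro ε hε
      obtain ⟨f, hf, hf1, hfε⟩ := hsmall ε hε
      refine ⟨f, hf1, ?_, hfε⟩
      rw [hker] at hf
      have h1 := hbelow f hf
      rw [hf1, mul_one] at h1
      rwa [hBT, norm_smul, norm_neg, Complex.norm_conj, hu, one_mul]
    obtain ⟨C, s₀, hC, hs₀, hpar⟩ := exists_mem_numericalRange_below_parabola hB hδ hsmall'
    have h0 : (0 : ℂ) ∈ closure (numericalRange B) := by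
      rw [Metric.mem_closure_iff]
      intro ε hε
      obtain ⟨f, hf1, -, hfε⟩ := hsmall' ε hε
      exact ⟨_, ⟨f, hf1, rfl⟩, by rwa [dist_zero_left]⟩
    have hev := eventually_frontier_im_div_le (convex_numericalRange B) hpos h0 hC hs₀ hpar
    have hfront : ∀ w : ℂ, z + u * w ∈ frontier (numericalRange A) ↔
        w ∈ frontier (numericalRange B) := by
      let e : ℂ ≃ₜ ℂ := (Homeomorph.mulLeft₀ u hu0).trans (Homeomorph.addLeft z)
      have h1 : e ⁻¹' numericalRange A = numericalRange B := Set.ext hcoord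
      intro w
      rw [← h1, ← e.preimage_frontier]
      rfl
    have hle : upperCurvature (numericalRange A) z u ≤ ((C : ℝ) : EReal) := by
      refine limsup_le_of_le (h := ?_)
      simp only [hfront]
      filter_upwards [hev] with w hw
      exact EReal.coe_le_coe_iff.2 hw
    rw [hcurv, top_le_iff] at hle
    exact EReal.coe_ne_top C hle
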